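/- Let $M$ be a smooth ($C^\infty$, Hausdorff, second countable, without boundary) manifold of dimension $m$ and let $\pi:TM\to M$ be its tangent bundle, a smooth manifold of dimension $2m$. A chart $(x^1,\dots,x^m)$ of $M$ induces a chart $(x^i,v^j)$ of $TM$. The complete lift of a smooth $p$-form $\alpha=\sum_{i_1<\dots<i_p}a_{i_1\cdots i_p}\,dx^{i_1}\wedge\dots\wedge dx^{i_p}$ on $M$ is the $p$-form $\widetilde\alpha$ on $TM$ given in these charts by $$\widetilde\alpha=\sum_{i_1<\dots<i_p}\Big(\sum_j v^j\frac{\partial a_{i_1\cdots i_p}}{\partial x^j}\,dx^{i_1}\wedge\dots\wedge dx^{i_p}+a_{i_1\cdots i_p}\sum_{k=1}^p dx^{i_1}\wedge\dots\wedge dv^{i_k}\wedge\dots\wedge dx^{i_p}\Big)$$ (so $\widetilde f=\sum_j v^j\,\partial f/\partial x^j$ for a function $f$). Let $H^p(M,\mathbb R)$ be the de Rham cohomology of $M$ and let $$H^p(TM)^\sim:=\frac{\{\widetilde\alpha:\ \alpha\in\Omega^p(M),\ d\alpha=0\}}{\{\widetilde\alpha:\ \alpha\in\Omega^p(M),\ d\alpha=0\}\cap\{d\beta:\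 \beta\in\Omega^{p-1}(TM)\}},$$ where $\Omega^{-1}=0$. Then: (a) For every $0\le p\le m$, the complete lift of each closed smooth $p$-form on $M$ is a closed smooth $p$-form on $TM$ (so that $H^p(TM)^\sim$ is a subspace of $H^p(TM,\mathbb R)$), and $[\alpha]\mapsto[\widetilde\alpha]$ is a well-defined surjective linear map $H^p(M,\mathbb R)\to H^p(TM)^\sim$. (b) $H^0(TM)^\sim=H^1(TM)^\sim=0$. (c) The map in (a) is not injective in general: for $M=\mathbb R^2\setminus\{0\}$ and $p=1$ it is not injective. -/

import Mathlib

open Set Manifold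
open scoped ContDiff

noncomputable section

namespace CompleteLift

section Forms

variable {E : Type*} [NormedAddCommGroup E] [NormedSpace ℝ E]
  {H : Type*} [TopologicalSpace H] (I : ModelWithCorners ℝ E H)
  (M : Type*) [TopologicalSpace M] [ChartedSpace H M]

/-- Not necessarily smooth differential `p`-forms on `M`: an alternating `p`-linear form on each
tangent space. -/
def FormField (p : ℕ) : Type _ :=
  ∀ x : M, (TangentSpace I x) [⋀^Fin p]→L[ℝ] ℝ

instance (p : ℕ) : AddCommGroup (FormField I M p) :=
  inferInstanceAs (AddCommGroup (∀ x : M, (TangentSpace I x) [⋀^Fin p]→L[ℝ] ℝ))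

instance (p : ℕ) : Module ℝ (FormField I M p) :=
  inferInstanceAs (Module ℝ (∀ x : M, (TangentSpace I x) [⋀^Fin p]→L[ℝ] ℝ))

variable {M} {p : ℕ}

/-- The expression of a form in the chart around `x₀`: its pull-back to the model space `E` along
the inverse of the chart (meaningful on the target of the chart). -/
def inChart (x₀ : M) (θ : FormField I M p) (y : E) : E [⋀^Fin p]→L[ℝ] ℝ :=
  (θ ((extChartAt I x₀).symm y)).compContinuousLinearMap
    (mfderivWithin 𝓘(ℝ, E) I (extChartAt I x₀).symm (range I) y :
      E →L[ℝ] TangentSpace I ((extChartAt I x₀).symm y))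

/-- A form is smooth if its expressions in the charts are smooth. -/
def IsSmoothForm (θ : FormField I M p) : Prop :=
  ∀ x₀ : M, ContDiffOn ℝ ∞ (inChart I x₀ θ) (extChartAt I x₀).target

theorem inChart_add (x₀ : M) (θ η : FormField I M p) :
    inChart I x₀ (θ + η) = inChart I x₀ θ + inChart I x₀ η := rfl

theorem inChart_smul (x₀ : M) (c : ℝ) (θ : FormField I M p) :
    inChart I x₀ (c • θ) = c • inChart I x₀ θ := rfl

theorem IsSmoothForm.differentiableWithinAt {θ : FormField I M p} (h : IsSmoothForm I θ) (x : M) :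
    DifferentiableWithinAt ℝ (inChart I x θ) (range I) (extChartAt I x x) :=
  (((h x).differentiableOn (by simp)) _ (mem_extChartAt_target x)).mono_of_mem_nhdsWithin
    (extChartAt_target_mem_nhdsWithin x)

theorem uniqueDiffWithinAt_extChartAt (x : M) :
    UniqueDiffWithinAt ℝ (range I) (extChartAt I x x) :=
  I.uniqueDiffOn _ (extChartAt_target_subset_range x (mem_extChartAt_target x))

variable (M p)

/-- The space `Ω^p(M)` of smooth `p`-forms on `M`. -/
def smoothForms : Submodule ℝ (FormField I M p) where
  carrier := {θ | IsSmoothForm I θ}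
  add_mem' := fun {θ η} hθ hη x₀ => by
    rw [inChart_add]; exact (hθ x₀).add (hη x₀)
  zero_mem' := fun x₀ =>
    (contDiffOn_const (c := (0 : E [⋀^Fin p]→L[ℝ] ℝ)) : ContDiffOn ℝ ∞ _ _)
  smul_mem' := fun c θ hθ x₀ => by
    rw [inChart_smul]; exact contDiffOn_const.smul (hθ x₀)

/-- The exterior derivative `d` on `Ω^p(M)`. At `x` it is computed in the chart around `x`. -/
def d : smoothForms I M p →ₗ[ℝ] FormField I M (p + 1) where
  toFun θ x :=
    (extDerivWithin (inChart I x θ.1) (range I) (extChartAt I x x)).compContinuousLinearMap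
      (mfderiv I 𝓘(ℝ, E) (extChartAt I x) x : TangentSpace I x →L[ℝ] E)
  map_add' θ η := by
    funext x
    rw [Submodule.coe_add, inChart_add, extDerivWithin_add (uniqueDiffWithinAt_extChartAt I x)
      (θ.2.differentiableWithinAt I x) (η.2.differentiableWithinAt I x)]
    rfl
  map_smul' c θ := by
    funext x
    rw [Submodule.coe_smul, inChart_smul, extDerivWithin_smul c _
      (uniqueDiffWithinAt_extChartAt I x)]
    rfl

/-- The space of closed smooth `p`-forms on `M`. -/
def closedForms : Submodule ℝ (smoothForms I M p) := LinearMap.ker (d I M p)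

/-- The space `{dγ : γ ∈ Ω^{p-1}(M)}` of exact `p`-forms on `M`; there are no forms of degree
`-1`, so for `p = 0` only the zero form is exact. -/
def exactForms : (p : ℕ) → Submodule ℝ (FormField I M p)
  | 0 => ⊥
  | q + 1 => LinearMap.range (d I M q)

/-- The closed `p`-forms that are exact, as a subspace of the space of closed `p`-forms. -/
def exactInClosed : Submodule ℝ (closedForms I M p) :=
  (exactForms I M p).comap ((smoothForms I M p).subtype ∘ₗ (closedForms I M p).subtype)

/-- The de Rham cohomology `H^p(M, ℝ)`: closed smooth forms modulo exact forms. -/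
abbrev DeRham : Type _ := closedForms I M p ⧸ exactInClosed I M p

end Forms

section Lift

variable {E : Type*} [NormedAddCommGroup E] [NormedSpace ℝ E]

/-- The complete lift to `E × E` of a form `θ` on a set `s` of the model space `E`, with coordinates
`(x, v)` on `E × E`. In linear coordinates, `θ = ∑ a_I dx^I` lifts to
`∑ v^j (∂a_I/∂x^j) dx^I + ∑ a_I ∑_k dx^{i_1} ∧ ⋯ ∧ dv^{i_k} ∧ ⋯ ∧ dx^{i_p}`;
see `modelLift_apply`. -/
def modelLift {p : ℕ} (s : Set E) (θ : E → E [⋀^Fin p]→L[ℝ] ℝ) (z : E × E) :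
    (E × E) [⋀^Fin p]→L[ℝ] ℝ :=
  (fderivWithin ℝ θ s z.1 z.2).compContinuousLinearMap (.fst ℝ E E) +
    (θ z.1).fderivCompContinuousLinearMap (.fst ℝ E E) (.snd ℝ E E)

theorem modelLift_apply {p : ℕ} (s : Set E) (θ : E → E [⋀^Fin p]→L[ℝ] ℝ) (z : E × E)
    (w : Fin p → E × E) :
    modelLift s θ z w = fderivWithin ℝ θ s z.1 z.2 (fun i => (w i).1) +
      ∑ k : Fin p, θ z.1 (Function.update (fun i => (w i).1) k (w k).2) := by
  simp only [modelLift, ContinuousAlternatingMap.add_apply,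
    ContinuousAlternatingMap.compContinuousLinearMap_apply,
    ContinuousAlternatingMap.fderivCompContinuousLinearMap_apply]
  congr 1
  refine Finset.sum_congr rfl fun k _ => congrArg _ (funext fun j => ?_)
  by_cases h : j = k
  · subst h; simp
  · simp [h]

theorem modelLift_add {p : ℕ} {s : Set E} {θ η : E → E [⋀^Fin p]→L[ℝ] ℝ} {z : E × E}
    (hs : UniqueDiffWithinAt ℝ s z.1) (hθ : DifferentiableWithinAt ℝ θ s z.1)
    (hη : DifferentiableWithinAt ℝ η s z.1) :
    modelLift s (θ + η) z = modelLift s θ z + modelLift s η z := by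
  ext w
  simp only [ContinuousAlternatingMap.add_apply, modelLift_apply, fderivWithin_add hs hθ hη,
    add_apply, Pi.add_apply, Finset.sum_add_distrib]
  ring

theorem modelLift_smul {p : ℕ} {s : Set E} {θ : E → E [⋀^Fin p]→L[ℝ] ℝ} {z : E × E}
    (hs : UniqueDiffWithinAt ℝ s z.1) (c : ℝ) :
    modelLift s (c • θ) z = c • modelLift s θ z := by
  ext w
  simp only [ContinuousAlternatingMap.smul_apply, modelLift_apply,
    Pi.smul_apply, Finset.smul_sum, smul_add]
  rw [fderivWithin_const_smul_field (f := θ) c hs]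
  rfl

variable {H : Type*} [TopologicalSpace H] (I : ModelWithCorners ℝ E H)
  (M : Type*) [TopologicalSpace M] [ChartedSpace H M] [IsManifold I ∞ M] (p : ℕ)

/-- In the charts that it induces on `TM`, a chart `φ` of `M` around `x` sends `(x, v)` to
`(φ x, v)`; `T_x M` is identified with `E` through `φ`. -/
theorem extChartAt_tangent_self (u : TangentBundle I M) :
    (extChartAt I.tangent u u : E × E) = (extChartAt I u.proj u.proj, u.snd) := by
  rw [show extChartAt I.tangent u = _ from FiberBundle.extChartAt u]
  refine Prod.ext rfl ?_
  exact tangentCoordChange_self (mem_extChartAt_source (I := I) u.proj)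

/-- The complete lift `α ↦ α~` from `Ω^p(M)` to forms on the total space `TM` of the tangent bundle.
At `u = (x, v) ∈ TM` it is computed in the chart of `TM` around `u`, which is the one induced by the
chart of `M` around `x`. -/
def lift : smoothForms I M p →ₗ[ℝ] FormField I.tangent (TangentBundle I M) p where
  toFun α u :=
    (modelLift (range I) (inChart I u.proj α.1)
        (extChartAt I.tangent u u : E × E)).compContinuousLinearMap
      (mfderiv I.tangent 𝓘(ℝ, E × E) (extChartAt I.tangent u) u :
        TangentSpace I.tangent u →L[ℝ] E × E)
  map_add' α β := by
    funext u
    have h : (extChartAt I.tangent u u : E × E).1 = extChartAt I u.proj u.proj :=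
      congrArg Prod.fst (extChartAt_tangent_self I M u)
    rw [Submodule.coe_add, inChart_add, modelLift_add]
    · rfl
    · rw [h]; exact uniqueDiffWithinAt_extChartAt I u.proj
    · rw [h]; exact α.2.differentiableWithinAt I u.proj
    · rw [h]; exact β.2.differentiableWithinAt I u.proj
  map_smul' c α := by
    funext u
    have h : (extChartAt I.tangent u u : E × E).1 = extChartAt I u.proj u.proj :=
      congrArg Prod.fst (extChartAt_tangent_self I M u)
    rw [Submodule.coe_smul, inChart_smul, modelLift_smul]
    · rfl
    · rw [h]; exact uniqueDiffWithinAt_extChartAt I u.proj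

/-- The space `{α~ : α ∈ Ω^p(M), dα = 0}` of complete lifts of closed `p`-forms on `M`. -/
def liftedClosedForms : Submodule ℝ (FormField I.tangent (TangentBundle I M) p) :=
  (closedForms I M p).map (lift I M p)

/-- The space `H^p(TM)^~`: complete lifts to `TM` of closed `p`-forms on `M`, modulo those of them
that are exact on `TM`. -/
abbrev LiftedCohomology : Type _ :=
  liftedClosedForms I M p ⧸
    (exactForms I.tangent (TangentBundle I M) p).comap (liftedClosedForms I M p).subtype

/-- The map `Φ` sends the class of each closed form `α` on `M` to the class of `α~`. -/
def IsInducedByLift (Φ : DeRham I M p →ₗ[ℝ] LiftedCohomology I M p) : Prop :=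
  ∀ α : closedForms I M p,
    Φ (Submodule.Quotient.mk α) =
      Submodule.Quotient.mk ⟨lift I M p α.1, Submodule.mem_map_of_mem α.2⟩

end Lift

/-- The punctured plane `ℝ² ∖ {0}`, an open submanifold of the plane. -/
def puncturedPlane : TopologicalSpace.Opens (EuclideanSpace ℝ (Fin 2)) :=
  ⟨{0}ᶜ, isOpen_compl_singleton⟩

end CompleteLift

end

open Filter Topology

noncomputable section

/-! Let `ι` be contraction with the tautological vector field along `TM → M`, which at `(x, v)`
takes the value `v`. The complete lift satisfies a Cartan formula `α~ = d(ια) + ι(dα)`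
(`extDeriv_modelContraction_add`), so the lift of a closed form of positive degree is `d(ια)`
(`lift_eq_d_contraction`). In degree 0 a closed function has zero differential, hence zero lift.
Thus lifts of closed forms are always exact, and the target vanishes in every degree, not only 0 and
1. Non-injectivity then amounts to a nonzero class in `H^1` of the punctured plane: the angle form,
closed by `extDeriv_angleForm` and without potential by `not_hasFDerivAt_angleCovector`. Transfer to
manifolds rests on `inChart_d` and `inChart_contraction`, which compute `d` and `ι` in any chart. -/

namespace CompleteLift

/-! ### Cartan's formula on the model space -/

section Model
variable {E : Type*} [NormedAddCommGroup E] [NormedSpace ℝ E]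

variable (E) in
/-- Currying of alternating forms in the first variable, as a continuous linear map. -/
def curryLeftCLM (q : ℕ) : E [⋀^Fin (q + 1)]→L[ℝ] ℝ →L[ℝ] (E →L[ℝ] E [⋀^Fin q]→L[ℝ] ℝ) :=
  ContinuousAlternatingMap.curryLeftLI.toContinuousLinearMap

/-- The contraction of a form on the model space with the tautological vector field along the
projection `E × E → E`, `(x, v) ↦ x`. -/
def modelContraction {q : ℕ} (θ : E → E [⋀^Fin (q + 1)]→L[ℝ] ℝ) (z : E × E) :
    (E × E) [⋀^Fin q]→L[ℝ] ℝ :=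
  ((θ z.1).curryLeft z.2).compContinuousLinearMap (.fst ℝ E E)

/-- Product rule in `(x, v)`. With `L` currying and `C` pull-back along the projection, the function
is `modelContraction θ` by definition. -/
theorem hasFDerivAt_clm_apply_prod {V W W' : Type*} [NormedAddCommGroup V] [NormedSpace ℝ V]
    [NormedAddCommGroup W] [NormedSpace ℝ W] [NormedAddCommGroup W'] [NormedSpace ℝ W']
    (L : V →L[ℝ] E →L[ℝ] W) (C : W →L[ℝ] W') {θ : E → V} {z : E × E}
    (h : DifferentiableAt ℝ θ z.1) :
    HasFDerivAt (fun z : E × E => C (L (θ z.1) z.2))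
      (C ∘L (L (θ z.1) ∘L .snd ℝ E E + (L ∘L fderiv ℝ θ z.1 ∘L .fst ℝ E E).flip z.2)) z := by
  have h1 : HasFDerivAt (fun z : E × E => L (θ z.1)) (L ∘L fderiv ℝ θ z.1 ∘L .fst ℝ E E) z :=
    L.hasFDerivAt.comp z (h.hasFDerivAt.comp z hasFDerivAt_fst)
  exact C.hasFDerivAt.comp z (h1.clm_apply hasFDerivAt_snd)

theorem contDiffOn_clm_apply_prod {V W W' : Type*} [NormedAddCommGroup V] [NormedSpace ℝ V]
    [NormedAddCommGroup W] [NormedSpace ℝ W] [NormedAddCommGroup W'] [NormedSpace ℝ W']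
    (L : V →L[ℝ] E →L[ℝ] W) (C : W →L[ℝ] W') {θ : E → V} {s : Set E} {n : WithTop ℕ∞}
    (h : ContDiffOn ℝ n θ s) :
    ContDiffOn ℝ n (fun z : E × E => C (L (θ z.1) z.2)) (s ×ˢ univ) := by
  have h1 : ContDiffOn ℝ n (fun z : E × E => θ z.1) (s ×ˢ univ) :=
    h.comp contDiffOn_fst fun z hz => hz.1
  exact C.contDiff.comp_contDiffOn ((L.contDiff.comp_contDiffOn h1).clm_apply contDiffOn_snd)

theorem hasFDerivAt_modelContraction {q : ℕ} {θ : E → E [⋀^Fin (q + 1)]→L[ℝ] ℝ} {z : E × E}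
    (h : DifferentiableAt ℝ θ z.1) :
    HasFDerivAt (modelContraction θ)
      ((ContinuousAlternatingMap.compContinuousLinearMapCLM (.fst ℝ E E)) ∘L
        ((curryLeftCLM E q (θ z.1)) ∘L .snd ℝ E E +
          (curryLeftCLM E q ∘L fderiv ℝ θ z.1 ∘L .fst ℝ E E).flip z.2)) z := by
  have h1 := hasFDerivAt_clm_apply_prod (V := E [⋀^Fin (q + 1)]→L[ℝ] ℝ)
    (W := E [⋀^Fin q]→L[ℝ] ℝ) (W' := (E × E) [⋀^Fin q]→L[ℝ] ℝ) (curryLeftCLM E q)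
    (ContinuousAlternatingMap.compContinuousLinearMapCLM (.fst ℝ E E)) h
  exact h1

theorem contDiffOn_modelContraction {q : ℕ} {θ : E → E [⋀^Fin (q + 1)]→L[ℝ] ℝ} {s : Set E}
    {n : WithTop ℕ∞} (h : ContDiffOn ℝ n θ s) :
    ContDiffOn ℝ n (modelContraction θ) (s ×ˢ univ) := by
  have h1 := contDiffOn_clm_apply_prod (V := E [⋀^Fin (q + 1)]→L[ℝ] ℝ)
    (W := E [⋀^Fin q]→L[ℝ] ℝ) (W' := (E × E) [⋀^Fin q]→L[ℝ] ℝ) (curryLeftCLM E q)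
    (ContinuousAlternatingMap.compContinuousLinearMapCLM (.fst ℝ E E)) h
  exact h1

/-- Cartan's formula for the complete lift: `θ~ = d (ι θ) + ι (d θ)`. -/
theorem extDeriv_modelContraction_add {q : ℕ} {θ : E → E [⋀^Fin (q + 1)]→L[ℝ] ℝ} {z : E × E}
    (h : DifferentiableAt ℝ θ z.1) :
    extDeriv (modelContraction θ) z + modelContraction (extDeriv θ) z = modelLift univ θ z := by
  ext w
  rw [modelLift_apply, ContinuousAlternatingMap.add_apply, extDeriv,
    (hasFDerivAt_modelContraction h).fderiv, fderivWithin_univ,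
    ContinuousAlternatingMap.alternatizeUncurryFin_apply]
  have h1 : modelContraction (extDeriv θ) z w =
      extDeriv θ z.1 (Matrix.vecCons z.2 (fun i => (w i).1)) := rfl
  rw [h1, extDeriv, ContinuousAlternatingMap.alternatizeUncurryFin_apply,
    Fin.sum_univ_succ (n := q + 1)]
  -- Moving slot `i` to the front costs the sign `(-1)^i`, the one carried by the alternatization.
  have h2 : ∀ i : Fin (q + 1),
      θ z.1 (Function.update (fun i => (w i).1) i (w i).2) =
      (-1) ^ (i : ℕ) • θ z.1 (Matrix.vecCons (w i).2 (i.removeNth fun i => (w i).1)) := by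
    intro i
    rw [← ContinuousAlternatingMap.map_insertNth, Fin.insertNth_removeNth]
  -- In `ι(dθ)`, term `i + 1` keeps `v` in front and has sign `(-1)^(i+1)`, so it cancels the
  -- derivative of `θ` in term `i` of `d(ιθ)`. Only term 0, the derivative of `θ` along `v`,
  -- survives.
  have h3 : ∀ i : Fin (q + 1),
      (i.succ.removeNth (Matrix.vecCons z.2 fun i => (w i).1) : Fin (q + 1) → E) =
      Matrix.vecCons z.2 (i.removeNth fun i => (w i).1) := by
    intro i
    funext j
    refine Fin.cases ?_ (fun j => ?_) j <;> simp [Fin.removeNth]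
  have h5 : ∀ i : Fin (q + 1), ((ContinuousAlternatingMap.compContinuousLinearMapCLM (.fst ℝ E E)) ∘L
        ((curryLeftCLM E q (θ z.1)) ∘L .snd ℝ E E +
          (curryLeftCLM E q ∘L fderiv ℝ θ z.1 ∘L .fst ℝ E E).flip z.2)) (w i) (i.removeNth w) =
      θ z.1 (Matrix.vecCons (w i).2 (i.removeNth fun i => (w i).1)) +
        fderiv ℝ θ z.1 (w i).1 (Matrix.vecCons z.2 (i.removeNth fun i => (w i).1)) :=
    fun i => rfl
  simp only [h2, h3, h5, smul_add, Finset.sum_add_distrib, Matrix.cons_val_succ, Fin.val_succ,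
    pow_succ, mul_neg, mul_one, neg_smul, Finset.sum_neg_distrib, Fin.val_zero, pow_zero, one_smul,
    Matrix.cons_val_zero]
  rw [show Fin.removeNth 0 (Matrix.vecCons z.2 fun i => (w i).1) = fun i => (w i).1 from rfl]
  abel

end Model

/-! ### The exterior derivative in arbitrary charts -/

section Charts

theorem minSmoothness_two_le_infty : minSmoothness ℝ 2 ≤ (∞ : WithTop ℕ∞) := by
  rw [minSmoothness_of_isRCLikeNormedField]
  exact WithTop.coe_le_coe.2 le_top

variable {E : Type*} [NormedAddCommGroup E] [NormedSpace ℝ E]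
  {H : Type*} [TopologicalSpace H] {I : ModelWithCorners ℝ E H}
  {M : Type*} [TopologicalSpace M] [ChartedSpace H M] {p : ℕ}

/-- All tangent spaces are definitionally `E`, so vectors at `x` and `x'` can be compared without
transport. -/
theorem FormField.apply_congr (θ : FormField I M p) {x x' : M} (h : x = x') {v w : Fin p → E}
    (hv : v = w) :
    (θ x : (TangentSpace I x) [⋀^Fin p]→L[ℝ] ℝ) v = (θ x' : (TangentSpace I x') [⋀^Fin p]→L[ℝ] ℝ) w := by
  subst h hv; rfl

theorem inChart_apply (x₀ : M) (θ : FormField I M p) (y : E) (v : Fin p → E) :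
    inChart I x₀ θ y v = θ ((extChartAt I x₀).symm y) fun i =>
      (mfderivWithin 𝓘(ℝ, E) I (extChartAt I x₀).symm (range I) y :
        E →L[ℝ] TangentSpace I ((extChartAt I x₀).symm y)) (v i) := rfl

variable [I.Boundaryless]

theorem eventually_symm_mem_source (x₀ x₁ : M) {y : E} (hy : y ∈ (extChartAt I x₀).target)
    (hy' : (extChartAt I x₀).symm y ∈ (extChartAt I x₁).source) :
    ∀ᶠ z in 𝓝 y, z ∈ (extChartAt I x₀).target ∧
      (extChartAt I x₀).symm z ∈ (extChartAt I x₁).source :=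
  Filter.Eventually.and (extChartAt_target_mem_nhds' hy)
    ((continuousAt_extChartAt_symm'' hy).eventually
      ((isOpen_extChartAt_source x₁).mem_nhds hy'))

theorem d_eq_zero_of_extDeriv (θ : smoothForms I M p)
    (h : ∀ x, extDeriv (inChart I x θ.1) (extChartAt I x x) = 0) : d I M p θ = 0 := by
  funext x
  have h1 : d I M p θ x =
    (extDerivWithin (inChart I x θ.1) (range I) (extChartAt I x x)).compContinuousLinearMap
      (mfderiv I 𝓘(ℝ, E) (extChartAt I x) x : TangentSpace I x →L[ℝ] E) := rfl
  rw [h1, I.range_eq_univ, extDerivWithin_univ, h x]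
  rfl

variable [IsManifold I ∞ M]

theorem contDiffAt_chart_change (x₀ x₁ : M) {y : E} (hy : y ∈ (extChartAt I x₀).target)
    (hy' : (extChartAt I x₀).symm y ∈ (extChartAt I x₁).source) :
    ContDiffAt ℝ ∞ (extChartAt I x₁ ∘ (extChartAt I x₀).symm) y := by
  have := contDiffWithinAt_ext_coord_change (n := ∞) (I := I) x₁ x₀ (y := y)
    (by simp only [PartialEquiv.trans_source, mem_inter_iff, mem_preimage]; exact ⟨hy, hy'⟩)
  rwa [I.range_eq_univ, contDiffWithinAt_univ] at this

theorem mdifferentiableAt_extChartAt_symm (x₀ : M) {y : E} (hy : y ∈ (extChartAt I x₀).target) :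
    MDifferentiableAt 𝓘(ℝ, E) I (extChartAt I x₀).symm y := by
  have hM : IsManifold I 1 M := .of_le (n := ∞) (by simp)
  have h := mdifferentiableWithinAt_extChartAt_symm hy
  rwa [I.range_eq_univ, mdifferentiableWithinAt_univ] at h

/-- Chain rule for the factorization of the inverse chart at `x₀` through the transition map and the
inverse chart at `x₁`. -/
theorem inChart_eq_pullback (θ : FormField I M p) (x₀ x₁ : M) {y : E}
    (hy : y ∈ (extChartAt I x₀).target)
    (hy' : (extChartAt I x₀).symm y ∈ (extChartAt I x₁).source) :
    inChart I x₀ θ y =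
      (inChart I x₁ θ ((extChartAt I x₁ ∘ (extChartAt I x₀).symm) y)).compContinuousLinearMap
        (fderiv ℝ (extChartAt I x₁ ∘ (extChartAt I x₀).symm) y) := by
  ext v
  have hM : IsManifold I 1 M := .of_le (n := ∞) (by simp)
  rw [ContinuousAlternatingMap.compContinuousLinearMap_apply, inChart_apply, inChart_apply]
  refine θ.apply_congr (((extChartAt I x₁).left_inv hy').symm) (funext fun i => ?_)
  have h1 := (eventually_symm_mem_source x₀ x₁ hy hy').mono fun z hz =>
    ((extChartAt I x₁).left_inv hz.2).symm
  have h2 : mfderiv 𝓘(ℝ, E) I ((extChartAt I x₁).symm ∘ extChartAt I x₁ ∘ (extChartAt I x₀).symm) y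
      = _ :=
    mfderiv_comp y
      (mdifferentiableAt_extChartAt_symm x₁ ((extChartAt I x₁).map_source hy'))
      ((contDiffAt_chart_change x₀ x₁ hy hy').differentiableAt (by simp)).mdifferentiableAt
  rw [mfderiv_eq_fderiv] at h2
  have h3 := (Filter.EventuallyEq.mfderiv_eq (I := 𝓘(ℝ, E)) (I' := I) h1).trans h2
  simp only [I.range_eq_univ, mfderivWithin_univ]
  exact congrArg (fun L : E →L[ℝ] E => L (v i)) h3

/-- `d` is defined with a different chart at each point; naturality of `extDeriv` under transition
maps makes the result chart-independent. -/
theorem inChart_d (θ : smoothForms I M p) (x₀ : M) {y : E} (hy : y ∈ (extChartAt I x₀).target) :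
    inChart I x₀ (d I M p θ) y = extDeriv (inChart I x₀ θ.1) y := by
  have hM : IsManifold I 1 M := .of_le (n := ∞) (by simp)
  set x := (extChartAt I x₀).symm y
  have hy' : (extChartAt I x₀).symm y ∈ (extChartAt I x).source := mem_extChartAt_source x
  have h1 : inChart I x₀ θ.1 =ᶠ[𝓝 y] fun z =>
      (inChart I x θ.1 ((extChartAt I x ∘ (extChartAt I x₀).symm) z)).compContinuousLinearMap
        (fderiv ℝ (extChartAt I x ∘ (extChartAt I x₀).symm) z) :=
    (eventually_symm_mem_source x₀ x hy hy').mono fun z hz =>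
      inChart_eq_pullback θ.1 x₀ x hz.1 hz.2
  have h2 : DifferentiableAt ℝ (inChart I x θ.1)
      ((extChartAt I x ∘ (extChartAt I x₀).symm) y) := by
    have := θ.2.differentiableWithinAt I x
    rwa [I.range_eq_univ, differentiableWithinAt_univ] at this
  rw [h1.extDeriv_eq, extDeriv_pullback h2 (contDiffAt_chart_change x₀ x hy hy')
    minSmoothness_two_le_infty]
  ext v
  have h2 : mfderiv 𝓘(ℝ, E) 𝓘(ℝ, E) (extChartAt I x ∘ (extChartAt I x₀).symm) y = _ :=
    mfderiv_comp y (mdifferentiableAt_extChartAt (by rwa [← extChartAt_source I]))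
      (mdifferentiableAt_extChartAt_symm x₀ hy)
  rw [mfderiv_eq_fderiv] at h2
  rw [ContinuousAlternatingMap.compContinuousLinearMap_apply, inChart_apply, h2]
  simp only [I.range_eq_univ, mfderivWithin_univ]
  rw [← extDerivWithin_univ, ← I.range_eq_univ]
  rfl

theorem isSmoothForm_d (θ : smoothForms I M p) : IsSmoothForm I (d I M p θ) := by
  intro x₀
  have h := (θ.2 x₀).fderiv_of_isOpen (m := ∞) (isOpen_extChartAt_target x₀) (by simp)
  have h1 : ContDiffOn ℝ ∞ (fun y => ContinuousAlternatingMap.alternatizeUncurryFinCLM ℝ E ℝ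
      (fderiv ℝ (inChart I x₀ θ.1) y)) (extChartAt I x₀).target :=
    (ContinuousLinearMap.contDiff _).comp_contDiffOn h
  exact h1.congr fun y hy => inChart_d θ x₀ hy

theorem d_d (θ : smoothForms I M p) : d I M (p + 1) ⟨d I M p θ, isSmoothForm_d θ⟩ = 0 := by
  refine d_eq_zero_of_extDeriv _ fun x => ?_
  have h1 : inChart I x (d I M p θ) =ᶠ[𝓝 (extChartAt I x x)] extDeriv (inChart I x θ.1) :=
    Filter.Eventually.mono (extChartAt_target_mem_nhds x) fun y hy => inChart_d θ x hy
  rw [h1.extDeriv_eq]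
  exact extDeriv_extDeriv_apply
    ((θ.2 x).contDiffAt (extChartAt_target_mem_nhds x)) minSmoothness_two_le_infty

theorem extDeriv_inChart_of_closed {θ : smoothForms I M p} (hθ : θ ∈ closedForms I M p) (x₀ : M)
    {y : E} (hy : y ∈ (extChartAt I x₀).target) : extDeriv (inChart I x₀ θ.1) y = 0 := by
  rw [← inChart_d θ x₀ hy, show d I M p θ = 0 from hθ]
  rfl

end Charts

/-! ### Contraction on the tangent bundle and exactness of lifts -/

section Lift

variable {E : Type*} [NormedAddCommGroup E] [NormedSpace ℝ E]
  {H : Type*} [TopologicalSpace H] {I : ModelWithCorners ℝ E H}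
  {M : Type*} [TopologicalSpace M] [ChartedSpace H M] [IsManifold I ∞ M]

theorem extChartAt_tangent_symm_proj (u₀ : TangentBundle I M) (z : E × E) :
    ((extChartAt I.tangent u₀).symm z).proj = (extChartAt I u₀.proj).symm z.1 := rfl

theorem mem_extChartAt_tangent_target (u₀ : TangentBundle I M) (z : E × E) :
    z ∈ (extChartAt I.tangent u₀).target ↔ z.1 ∈ (extChartAt I u₀.proj).target := by
  rw [show extChartAt I.tangent u₀ = _ from FiberBundle.extChartAt u₀]
  simp only [PartialEquiv.trans_target, PartialEquiv.prod_target, PartialEquiv.refl_target, mem_inter_iff,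
    mem_prod, mem_univ, and_true, mem_preimage, and_iff_left_iff_imp]
  intro h
  refine ⟨?_, mem_univ _⟩
  have := (extChartAt I u₀.proj).map_target h
  rwa [extChartAt_source] at this

/-- The tangent bundle is trivialized by the differentials of the charts of `M`. -/
theorem extChartAt_tangent_symm_snd (u₀ : TangentBundle I M) {z : E × E}
    (hz : z.1 ∈ (extChartAt I u₀.proj).target) :
    ((extChartAt I.tangent u₀).symm z).snd =
      (mfderivWithin 𝓘(ℝ, E) I (extChartAt I u₀.proj).symm (range I) z.1 : E →L[ℝ] E) z.2 := by
  have hM : IsManifold I 1 M := .of_le (n := ∞) (by simp)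
  have hs : (extChartAt I u₀.proj).symm z.1 ∈ (chartAt H u₀.proj).source := by
    rw [← extChartAt_source I]; exact (extChartAt I u₀.proj).map_target hz
  have h1 := TangentBundle.symmL_trivializationAt (I := I) hs
  rw [(extChartAt I u₀.proj).right_inv hz] at h1
  have h2 := congrArg (fun L : E →L[ℝ] E => L z.2) h1
  refine Eq.trans ?_ h2
  have h3 := (trivializationAt E (TangentSpace I) u₀.proj).mk_symm
    (b := (extChartAt I u₀.proj).symm z.1) hs z.2
  have h4 := congrArg (fun u : TangentBundle I M => (u.snd : E)) h3.symm
  rw [show extChartAt I.tangent u₀ = _ from FiberBundle.extChartAt u₀]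
  exact h4.trans (Bundle.Trivialization.symmL_apply (R := ℝ) _ hs z.2).symm

theorem mdifferentiableAt_proj (u : TangentBundle I M) :
    MDifferentiableAt I.tangent I (Bundle.TotalSpace.proj : TangentBundle I M → M) u := by
  have := Bundle.contMDiffAt_proj (IB := I) (n := ∞) (TangentSpace I : M → Type _) (p := u)
  exact this.mdifferentiableAt (by simp)

variable (I M) in
/-- The contraction of a form on `M` with the tautological vector field along the projection
`TM → M`: at `(x, v)` it is `w ↦ α_x(v, dπ w₁, …, dπ w_q)`. -/
def contraction {q : ℕ} (α : FormField I M (q + 1)) : FormField I.tangent (TangentBundle I M) q :=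
  fun u => (ContinuousAlternatingMap.curryLeft (E := E) (α u.proj) u.snd).compContinuousLinearMap
    (mfderiv I.tangent I Bundle.TotalSpace.proj u :
      TangentSpace I.tangent u →L[ℝ] TangentSpace I u.proj)

theorem inChart_contraction [I.Boundaryless] {q : ℕ} (α : FormField I M (q + 1))
    (u₀ : TangentBundle I M) {z : E × E} (hz : z ∈ (extChartAt I.tangent u₀).target) :
    inChart I.tangent u₀ (contraction I M α) z = modelContraction (inChart I u₀.proj α) z := by
  have hz' := (mem_extChartAt_tangent_target u₀ z).1 hz
  ext w
  rw [inChart_apply]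
  have h1 : modelContraction (inChart I u₀.proj α) z w =
    α ((extChartAt I u₀.proj).symm z.1) fun i =>
      (mfderivWithin 𝓘(ℝ, E) I (extChartAt I u₀.proj).symm (range I) z.1 : E →L[ℝ] E)
        ((Matrix.vecCons z.2 fun i => (w i).1 : Fin (q + 1) → E) i) := rfl
  rw [h1]
  refine α.apply_congr (extChartAt_tangent_symm_proj u₀ z) (funext fun i => ?_)
  -- Slot 0 holds the tautological vector. The other slots compare the two chain rules for one map:
  -- bundle projection after inverse chart of `TM`, and inverse chart of `M` after `Prod.fst`.
  refine Fin.cases ?_ (fun i => ?_) i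
  · exact extChartAt_tangent_symm_snd u₀ hz'
  simp only [I.range_eq_univ, I.tangent.range_eq_univ, mfderivWithin_univ]
  have h2 : mfderiv 𝓘(ℝ, E × E) I (Bundle.TotalSpace.proj ∘ (extChartAt I.tangent u₀).symm) z = _ :=
    mfderiv_comp z (mdifferentiableAt_proj _) (mdifferentiableAt_extChartAt_symm u₀ hz)
  have h3 : mfderiv 𝓘(ℝ, E × E) I ((extChartAt I u₀.proj).symm ∘ (Prod.fst : E × E → E)) z = _ :=
    mfderiv_comp (I' := 𝓘(ℝ, E)) z (mdifferentiableAt_extChartAt_symm u₀.proj hz')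
      (differentiableAt_fst.mdifferentiableAt)
  rw [mfderiv_eq_fderiv, fderiv_fst] at h3
  exact congrArg (fun L : E × E →L[ℝ] E => L (w i)) (h2.symm.trans h3)

theorem isSmoothForm_contraction [I.Boundaryless] {q : ℕ} (α : smoothForms I M (q + 1)) :
    IsSmoothForm I.tangent (contraction I M α.1) := fun u₀ => by
  refine (contDiffOn_modelContraction (α.2 u₀.proj)).congr_mono
    (fun z hz => inChart_contraction α.1 u₀ hz) fun z hz => ?_
  exact ⟨(mem_extChartAt_tangent_target u₀ z).1 hz, mem_univ _⟩

/-- The complete lift of a closed form `α` of positive degree is the exterior derivative of the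
contraction of `α`. -/
theorem lift_eq_d_contraction [I.Boundaryless] {q : ℕ} {α : smoothForms I M (q + 1)}
    (hα : α ∈ closedForms I M (q + 1)) :
    lift I M (q + 1) α =
      d I.tangent (TangentBundle I M) q ⟨contraction I M α.1, isSmoothForm_contraction α⟩ := by
  funext u
  set z : E × E := extChartAt I.tangent u u
  have hzt : z ∈ (extChartAt I.tangent u).target := mem_extChartAt_target u
  have hzt' := (mem_extChartAt_tangent_target u z).1 hzt
  have h1 : inChart I.tangent u (contraction I M α.1) =ᶠ[𝓝 z]
      modelContraction (inChart I u.proj α.1) :=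
    Filter.Eventually.mono (extChartAt_target_mem_nhds u) fun y hy => inChart_contraction α.1 u hy
  have h2 : DifferentiableAt ℝ (inChart I u.proj α.1) z.1 :=
    ((α.2 u.proj).contDiffAt (extChartAt_target_mem_nhds' hzt')).differentiableAt (by simp)
  have h3 : modelLift (range I) (inChart I u.proj α.1) z =
      extDerivWithin (inChart I.tangent u (contraction I M α.1)) (range I.tangent) z := by
    rw [I.tangent.range_eq_univ, I.range_eq_univ, extDerivWithin_univ, h1.extDeriv_eq,
      ← extDeriv_modelContraction_add h2]
    have h4 : modelContraction (extDeriv (inChart I u.proj α.1)) z = 0 := by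
      rw [modelContraction, extDeriv_inChart_of_closed hα u.proj hzt']
      rfl
    rw [h4, add_zero]
  exact congrArg (fun f : (E × E) [⋀^Fin (q + 1)]→L[ℝ] ℝ => f.compContinuousLinearMap
      (mfderiv I.tangent 𝓘(ℝ, E × E) (extChartAt I.tangent u) u :
        TangentSpace I.tangent u →L[ℝ] E × E)) h3

/-- The lift of a function is `(x, v) ↦ df_x(v)`. -/
theorem lift_eq_zero_of_closed [I.Boundaryless] {α : smoothForms I M 0}
    (hα : α ∈ closedForms I M 0) : lift I M 0 α = 0 := by
  funext u
  set z : E × E := extChartAt I.tangent u u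
  have hzt' := (mem_extChartAt_tangent_target u z).1 (mem_extChartAt_target u)
  have h2 : DifferentiableAt ℝ (inChart I u.proj α.1) z.1 :=
    ((α.2 u.proj).contDiffAt (extChartAt_target_mem_nhds' hzt')).differentiableAt (by simp)
  have h3 : modelLift (range I) (inChart I u.proj α.1) z = 0 := by
    ext w
    have h4 := congrArg (fun f => f fun _ => z.2) (extDeriv_inChart_of_closed hα u.proj hzt')
    simp only [extDeriv, ContinuousAlternatingMap.alternatizeUncurryFin_apply] at h4
    rw [modelLift_apply, I.range_eq_univ, fderivWithin_univ]
    simpa [Subsingleton.elim (fun i => (w i).1) (Fin.tail fun _ : Fin 1 => z.2)] using h4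
  exact congrArg (fun f : (E × E) [⋀^Fin 0]→L[ℝ] ℝ => f.compContinuousLinearMap
      (mfderiv I.tangent 𝓘(ℝ, E × E) (extChartAt I.tangent u) u :
        TangentSpace I.tangent u →L[ℝ] E × E)) h3

theorem lift_mem_exactForms [I.Boundaryless] {p : ℕ} {α : smoothForms I M p}
    (hα : α ∈ closedForms I M p) :
    lift I M p α ∈ exactForms I.tangent (TangentBundle I M) p := by
  cases p with
  | zero => exact lift_eq_zero_of_closed hα
  | succ q => exact ⟨_, (lift_eq_d_contraction hα).symm⟩

theorem exists_closed_eq_lift [I.Boundaryless] {p : ℕ} {α : smoothForms I M p}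
    (hα : α ∈ closedForms I M p) :
    ∃ β ∈ closedForms I.tangent (TangentBundle I M) p, β.1 = lift I M p α := by
  cases p with
  | zero => exact ⟨0, Submodule.zero_mem _, (lift_eq_zero_of_closed hα).symm⟩
  | succ q =>
    exact ⟨⟨_, isSmoothForm_d ⟨_, isSmoothForm_contraction α⟩⟩, d_d _,
      (lift_eq_d_contraction hα).symm⟩

variable (I M) in
theorem subsingleton_liftedCohomology [I.Boundaryless] (p : ℕ) :
    Subsingleton (LiftedCohomology I M p) := by
  refine Submodule.Quotient.subsingleton_iff.2 (eq_top_iff.2 ?_)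
  rintro ⟨_, α, hα, rfl⟩ -
  exact lift_mem_exactForms hα

variable (I M) in
/-- The map induced by the complete lift on cohomology. -/
theorem exists_isInducedByLift_surjective [I.Boundaryless] (p : ℕ) :
    ∃ Φ : DeRham I M p →ₗ[ℝ] LiftedCohomology I M p,
      IsInducedByLift I M p Φ ∧ Function.Surjective Φ := by
  let L : closedForms I M p →ₗ[ℝ] liftedClosedForms I M p :=
    ((lift I M p).comp (closedForms I M p).subtype).codRestrict _
      fun α => Submodule.mem_map_of_mem α.2
  refine ⟨Submodule.mapQ _ _ L fun α _ => lift_mem_exactForms α.2, fun α => rfl, ?_⟩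
  intro y
  -- The numerator of the target is by definition the image of the closed forms.
  obtain ⟨⟨_, α, hα, rfl⟩, rfl⟩ := Submodule.Quotient.mk_surjective _ y
  exact ⟨Submodule.Quotient.mk ⟨α, hα⟩, rfl⟩

end Lift

/-! ### The angle form on the punctured plane -/

section PuncturedPlane

local notation "ℝ²" => EuclideanSpace ℝ (Fin 2)

theorem extChartAt_puncturedPlane_target (x : puncturedPlane) :
    (extChartAt (𝓡 2) x).target = {0}ᶜ := by
  simp only [extChartAt, TopologicalSpace.Opens.chartAt_eq, mfld_simps,
    OpenPartialHomeomorph.subtypeRestr_def]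
  rw [chartAt_self_eq]
  simp
  rfl

theorem coe_extChartAt_puncturedPlane_symm (x : puncturedPlane) {y : ℝ²} (hy : y ≠ 0) :
    ((extChartAt (𝓡 2) x).symm y : ℝ²) = y :=
  (extChartAt (𝓡 2) x).right_inv (x := y) (by rw [extChartAt_puncturedPlane_target]; exact hy)

theorem mfderiv_extChartAt_puncturedPlane_symm (x₀ : puncturedPlane) {y : ℝ²} (hy : y ≠ 0) :
    mfderivWithin 𝓘(ℝ, ℝ²) (𝓡 2) (extChartAt (𝓡 2) x₀).symm (range (𝓡 2)) y =
      ContinuousLinearMap.id ℝ ℝ² := by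
  -- All charts are the inclusion, so the chart may be centred at `y`, where the differential of its
  -- inverse is the identity.
  have h1 : (extChartAt (𝓡 2) x₀).symm =ᶠ[𝓝 y]
      (extChartAt (𝓡 2) (⟨y, hy⟩ : puncturedPlane)).symm := by
    filter_upwards [isOpen_compl_singleton.mem_nhds hy] with z hz
    exact Subtype.ext ((coe_extChartAt_puncturedPlane_symm _ hz).trans
      (coe_extChartAt_puncturedPlane_symm _ hz).symm)
  have h2 := mfderivWithin_range_extChartAt_symm (I := 𝓡 2) (x := (⟨y, hy⟩ : puncturedPlane))
  rw [(𝓡 2).range_eq_univ, mfderivWithin_univ] at h2 ⊢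
  exact (Filter.EventuallyEq.mfderiv_eq (I := 𝓘(ℝ, ℝ²)) (I' := 𝓡 2) h1).trans h2

/-- The restriction to the punctured plane of a form on the plane. -/
def restrictForm {p : ℕ} (θ : ℝ² → ℝ² [⋀^Fin p]→L[ℝ] ℝ) : FormField (𝓡 2) puncturedPlane p :=
  fun x => θ x

theorem inChart_restrictForm {p : ℕ} (θ : ℝ² → ℝ² [⋀^Fin p]→L[ℝ] ℝ) (x₀ : puncturedPlane) {y : ℝ²}
    (hy : y ≠ 0) : inChart (𝓡 2) x₀ (restrictForm θ) y = θ y := by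
  ext v
  rw [inChart_apply, mfderiv_extChartAt_puncturedPlane_symm x₀ hy]
  exact congrArg (fun z => θ z v) (coe_extChartAt_puncturedPlane_symm x₀ hy)

theorem isSmoothForm_restrictForm {p : ℕ} {θ : ℝ² → ℝ² [⋀^Fin p]→L[ℝ] ℝ}
    (h : ContDiffOn ℝ ∞ θ {0}ᶜ) : IsSmoothForm (𝓡 2) (restrictForm θ) := fun x₀ => by
  rw [extChartAt_puncturedPlane_target]
  exact h.congr fun y hy => inChart_restrictForm θ x₀ hy

/-- The covector `(x dy - y dx) / (x² + y²)` at a point of the plane. -/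
def angleCovector (y : ℝ²) : ℝ² →L[ℝ] ℝ :=
  (y 0 ^ 2 + y 1 ^ 2)⁻¹ • (y 0 • EuclideanSpace.proj 1 - y 1 • EuclideanSpace.proj 0)

theorem angleCovector_apply (y v : ℝ²) :
    angleCovector y v = (y 0 ^ 2 + y 1 ^ 2)⁻¹ * (y 0 * v 1 - y 1 * v 0) := rfl

/-- The angle form `(x dy - y dx) / (x² + y²)` on the plane. -/
def angleForm (y : ℝ²) : ℝ² [⋀^Fin 1]→L[ℝ] ℝ :=
  ContinuousAlternatingMap.ofSubsingleton ℝ ℝ² ℝ 0 (angleCovector y)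

theorem sq_add_sq_ne_zero_of_ne_zero {y : ℝ²} (hy : y ≠ 0) : y 0 ^ 2 + y 1 ^ 2 ≠ 0 := by
  contrapose! hy
  ext i
  fin_cases i
  · simpa using (by nlinarith [sq_nonneg (y 0), sq_nonneg (y 1)] : y 0 = 0)
  · simpa using (by nlinarith [sq_nonneg (y 0), sq_nonneg (y 1)] : y 1 = 0)

theorem contDiffOn_angleForm : ContDiffOn ℝ ∞ angleForm {0}ᶜ := by
  have h : ContDiffOn ℝ ∞ angleCovector {0}ᶜ := by
    have h0 : ∀ i : Fin 2, ContDiff ℝ ∞ fun y : ℝ² => y i := fun i =>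
      (EuclideanSpace.proj i : ℝ² →L[ℝ] ℝ).contDiff
    refine ContDiffOn.smul (ContDiffOn.inv ?_ fun y hy => sq_add_sq_ne_zero_of_ne_zero hy) ?_
    · exact (((h0 0).pow 2).add ((h0 1).pow 2)).contDiffOn
    · exact (((h0 0).smul contDiff_const).sub ((h0 1).smul contDiff_const)).contDiffOn
  have hL := ContinuousLinearMap.contDiff (𝕜 := ℝ) (E := ℝ² →L[ℝ] ℝ) (F := ℝ² [⋀^Fin 1]→L[ℝ] ℝ)
    (n := ∞) (ContinuousAlternatingMap.ofSubsingletonLIE (𝕜 := ℝ) (E := ℝ²) (F := ℝ)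
      (0 : Fin 1)).toContinuousLinearEquiv.toContinuousLinearMap
  exact hL.comp_contDiffOn h

theorem hasFDerivAt_angleForm_apply {y : ℝ²} (hy : y ≠ 0) (w : Fin 1 → ℝ²) :
    HasFDerivAt (fun y => angleForm y w)
      ((y 0 ^ 2 + y 1 ^ 2)⁻¹ • (w 0 1 • EuclideanSpace.proj 0 - w 0 0 • EuclideanSpace.proj 1) -
        (2 * (y 0 * w 0 1 - y 1 * w 0 0) / (y 0 ^ 2 + y 1 ^ 2) ^ 2) •
          (y 0 • EuclideanSpace.proj 0 + y 1 • EuclideanSpace.proj 1) : ℝ² →L[ℝ] ℝ) y := by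
  have h0 : ∀ i : Fin 2, HasFDerivAt (fun y : ℝ² => y i) (EuclideanSpace.proj i : ℝ² →L[ℝ] ℝ) y := fun i =>
    (EuclideanSpace.proj i : ℝ² →L[ℝ] ℝ).hasFDerivAt
  have hne := sq_add_sq_ne_zero_of_ne_zero hy
  have h1 := (hasDerivAt_inv hne).comp_hasFDerivAt y (((h0 0).pow 2).add ((h0 1).pow 2))
  have h2 := ((h0 0).mul_const (w 0 1)).sub ((h0 1).mul_const (w 0 0))
  refine (h1.mul h2).congr_fderiv ?_
  ext v
  simp
  field_simp
  ring

/-- With `r² = x² + y²`, the coefficient of `dx ∧ dy` is `∂_x(x/r²) + ∂_y(y/r²) = 2/r² - 2r²/r⁴ =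
0`. -/
theorem extDeriv_angleForm {y : ℝ²} (hy : y ≠ 0) : extDeriv angleForm y = 0 := by
  have hd : DifferentiableAt ℝ angleForm y :=
    (contDiffOn_angleForm.contDiffAt (isOpen_compl_singleton.mem_nhds hy)).differentiableAt
      (by simp)
  ext v
  rw [extDeriv_apply hd, Fin.sum_univ_two, (hasFDerivAt_angleForm_apply hy _).fderiv,
    (hasFDerivAt_angleForm_apply hy _).fderiv]
  have := sq_add_sq_ne_zero_of_ne_zero hy
  simp [Fin.removeNth]
  field_simp
  ring

/-- The angle form on the punctured plane. -/
def puncturedPlaneAngleForm : smoothForms (𝓡 2) puncturedPlane 1 :=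
  ⟨restrictForm angleForm, isSmoothForm_restrictForm contDiffOn_angleForm⟩

theorem puncturedPlaneAngleForm_mem_closedForms :
    puncturedPlaneAngleForm ∈ closedForms (𝓡 2) puncturedPlane 1 := by
  refine d_eq_zero_of_extDeriv _ fun x => ?_
  have hx : extChartAt (𝓡 2) x x ≠ 0 := x.2
  have h : inChart (𝓡 2) x puncturedPlaneAngleForm.1 =ᶠ[𝓝 (extChartAt (𝓡 2) x x)] angleForm := by
    filter_upwards [isOpen_compl_singleton.mem_nhds hx] with z hz
    exact inChart_restrictForm angleForm x hz
  rw [h.extDeriv_eq, extDeriv_angleForm hx]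

/-- The angle form has no potential on the complement of the origin, as its integral over the unit
circle does not vanish. -/
theorem not_hasFDerivAt_angleCovector (g : ℝ² → ℝ) :
    ¬ ∀ y ≠ 0, HasFDerivAt g (angleCovector y) y := by
  intro hg
  let γ : ℝ → ℝ² := fun t =>
    Real.cos t • EuclideanSpace.single 0 1 + Real.sin t • EuclideanSpace.single 1 1
  have h0 : ∀ t, γ t 0 = Real.cos t := fun t => by simp [γ]
  have h1 : ∀ t, γ t 1 = Real.sin t := fun t => by simp [γ]
  have hne : ∀ t, γ t ≠ 0 := fun t h => by
    have := Real.sin_sq_add_cos_sq t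
    rw [← h0, ← h1, h] at this
    simp at this
  have hγ : ∀ t, HasDerivAt γ
      (-Real.sin t • EuclideanSpace.single 0 1 + Real.cos t • EuclideanSpace.single 1 1) t :=
    fun t => ((Real.hasDerivAt_cos t).smul_const _).add ((Real.hasDerivAt_sin t).smul_const _)
  -- The angle form is 1 on the velocity of `γ`, so `g ∘ γ` would grow like `t`, although `γ` closes
  -- up at `2π`.
  have hh : ∀ t : ℝ, HasDerivAt (fun t : ℝ => g (γ t) - t) 0 t := fun t => by
    refine (((hg _ (hne t)).comp_hasDerivAt t (hγ t)).sub (hasDerivAt_id t)).congr_deriv ?_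
    rw [angleCovector_apply, h0, h1]
    simp [← sq]
  have h := is_const_of_deriv_eq_zero (fun t => (hh t).differentiableAt) (fun t => (hh t).deriv)
    0 (2 * Real.pi)
  simp [γ] at h
  linarith [Real.pi_pos]

theorem puncturedPlaneAngleForm_notMem_exactForms :
    puncturedPlaneAngleForm.1 ∉ exactForms (𝓡 2) puncturedPlane 1 := by
  rintro ⟨f, hf⟩
  -- Any base point serves: a single chart covers the whole punctured plane, so a primitive read
  -- there is a global potential.
  let x₀ : puncturedPlane := ⟨EuclideanSpace.single 0 1, by simp [puncturedPlane]⟩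
  refine not_hasFDerivAt_angleCovector (fun y => inChart (𝓡 2) x₀ f.1 y 0) fun y hy => ?_
  have hyt : y ∈ (extChartAt (𝓡 2) x₀).target := by
    rwa [extChartAt_puncturedPlane_target]
  have h1 := inChart_d f x₀ hyt
  rw [hf, show inChart (𝓡 2) x₀ puncturedPlaneAngleForm.1 y = angleForm y from
    inChart_restrictForm angleForm x₀ hy] at h1
  have h2 : DifferentiableAt ℝ (inChart (𝓡 2) x₀ f.1) y :=
    ((f.2 x₀).contDiffAt (extChartAt_target_mem_nhds' hyt)).differentiableAt (by simp)
  -- A 0-form is determined by its value on the empty tuple, here written `0`; this turns `d` into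
  -- the Fréchet derivative.
  have h3 : inChart (𝓡 2) x₀ f.1 = fun y => ContinuousAlternatingMap.constOfIsEmpty ℝ ℝ² (Fin 0)
      (inChart (𝓡 2) x₀ f.1 y 0) := by
    funext y
    ext v
    simp [Subsingleton.elim v 0]
  have h4 : DifferentiableAt ℝ (fun y => inChart (𝓡 2) x₀ f.1 y 0) y :=
    (ContinuousAlternatingMap.constOfIsEmptyLIE ℝ ℝ² ℝ
      (Fin 0)).symm.toContinuousLinearEquiv.differentiableAt.comp y h2
  rw [h3, extDeriv_constOfIsEmpty] at h1
  exact h4.hasFDerivAt.congr_fderiv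
    ((ContinuousAlternatingMap.ofSubsingleton ℝ ℝ² ℝ (0 : Fin 1)).injective h1.symm)

theorem not_injective_of_isInducedByLift
    {Φ : DeRham (𝓡 2) puncturedPlane 1 →ₗ[ℝ] LiftedCohomology (𝓡 2) puncturedPlane 1} :
    ¬ Function.Injective Φ := by
  intro h
  have := subsingleton_liftedCohomology (𝓡 2) puncturedPlane 1
  have h1 : (Submodule.Quotient.mk ⟨_, puncturedPlaneAngleForm_mem_closedForms⟩ :
      DeRham (𝓡 2) puncturedPlane 1) = 0 := h (Subsingleton.elim _ _)
  exact puncturedPlaneAngleForm_notMem_exactForms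
    ((Submodule.Quotient.mk_eq_zero (exactInClosed (𝓡 2) puncturedPlane 1)).1 h1)

end PuncturedPlane

end CompleteLift

end

theorem mainTheorem12 :
    (∀ (m : ℕ) (M : Type*) [TopologicalSpace M] [T2Space M] [SecondCountableTopology M]
        [ChartedSpace (EuclideanSpace ℝ (Fin m)) M] [IsManifold (𝓡 m) ∞ M],
      (∀ p : ℕ, p ≤ m →
        (∀ α ∈ CompleteLift.closedForms (𝓡 m) M p,
          ∃ β ∈ CompleteLift.closedForms (𝓡 m).tangent (TangentBundle (𝓡 m) M) p,
            β.1 = CompleteLift.lift (𝓡 m) M p α) ∧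
        ∃ Φ : CompleteLift.DeRham (𝓡 m) M p →ₗ[ℝ] CompleteLift.LiftedCohomology (𝓡 m) M p,
          CompleteLift.IsInducedByLift (𝓡 m) M p Φ ∧ Function.Surjective Φ) ∧
      Subsingleton (CompleteLift.LiftedCohomology (𝓡 m) M 0) ∧
      Subsingleton (CompleteLift.LiftedCohomology (𝓡 m) M 1)) ∧
    (∃ Φ : CompleteLift.DeRham (𝓡 2) CompleteLift.puncturedPlane 1 →ₗ[ℝ]
        CompleteLift.LiftedCohomology (𝓡 2) CompleteLift.puncturedPlane 1,
      CompleteLift.IsInducedByLift (𝓡 2) CompleteLift.puncturedPlane 1 Φ ∧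
        ¬ Function.Injective Φ) := by
  refine ⟨fun m M _ _ _ _ _ => ⟨fun p _ => ⟨fun α hα => CompleteLift.exists_closed_eq_lift hα,
    CompleteLift.exists_isInducedByLift_surjective (𝓡 m) M p⟩,
    CompleteLift.subsingleton_liftedCohomology (𝓡 m) M 0,
    CompleteLift.subsingleton_liftedCohomology (𝓡 m) M 1⟩, ?_⟩
  obtain ⟨Φ, hΦ, -⟩ := CompleteLift.exists_isInducedByLift_surjective (𝓡 2)
    CompleteLift.puncturedPlane 1
  exact ⟨Φ, hΦ, CompleteLift.not_injective_of_isInducedByLift⟩
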